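/- For every function $f:\mathbb{N}\to\mathbb{N}$ there is a (simple, undirected) graph $G$ with $|V(G)| = 2^{\aleph_1}$ and chromatic number $\chi(G)=\aleph_1$ such that, for every natural number $k\ge 3$, every subgraph of $G$ with fewer than $f(k)$ vertices has chromatic number less than $k$; that is, $f_G(k)\ge f(k)$, where $f_G(k)$ denotes the least natural number $m$ for which there exists a subgraph of $G$ with exactly $m$ vertices and chromatic number at least $k$. -/

import Mathlib

open Cardinal

universe u

/-- The chromatic number of a graph as a cardinal: the least cardinality of a set of colours
that admits a proper colouring. -/
noncomputable def SimpleGraph.cardChromaticNumber {V : Type u} (G : SimpleGraph V) :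
    Cardinal.{u} :=
  sInf {κ : Cardinal.{u} | ∃ C : Type u, #C = κ ∧ Nonempty (G.Coloring C)}

/-- The set of natural numbers `m` for which some subgraph of `G` has exactly `m` vertices and
chromatic number at least `k`. -/
def SimpleGraph.subgraphOrders {V : Type u} (G : SimpleGraph V) (k : ℕ) : Set ℕ :=
  {m : ℕ | ∃ H : G.Subgraph, #H.verts = (m : Cardinal.{u}) ∧
    (k : Cardinal.{u}) ≤ H.coe.cardChromaticNumber}

/-- The function `f_G`: the least number of vertices of a subgraph of `G` with chromatic number
at least `k`. -/
noncomputable def SimpleGraph.leastSubgraphOrder {V : Type u} (G : SimpleGraph V) (k : ℕ) : ℕ :=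
  sInf (G.subgraphOrders k)

/-- The chromatic number is attained by a colouring. -/
theorem SimpleGraph.exists_coloring_card {V : Type u} (G : SimpleGraph V) :
    ∃ C : Type u, #C = G.cardChromaticNumber ∧ Nonempty (G.Coloring C) :=
  csInf_mem (s := {κ : Cardinal.{u} | ∃ C : Type u, #C = κ ∧ Nonempty (G.Coloring C)})
    ⟨#V, V, rfl, ⟨G.selfColoring⟩⟩

/-- For a graph with infinite chromatic number, the infimum that defines `leastSubgraphOrder` is
a minimum (De Bruijn and Erdős). -/
theorem SimpleGraph.isLeast_leastSubgraphOrder {V : Type u} (G : SimpleGraph V)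
    (hG : ℵ₀ ≤ G.cardChromaticNumber) (k : ℕ) :
    IsLeast (G.subgraphOrders k) (G.leastSubgraphOrder k) := by
  have hne : (G.subgraphOrders k).Nonempty := by
    by_contra hempty
    have key : ∀ H : G.Subgraph, H.verts.Finite →
        Nonempty (H.coe →g (⊤ : SimpleGraph (Fin k))) := by
      intro H hH
      have hlt : H.coe.cardChromaticNumber < (k : Cardinal.{u}) := by
        by_contra hle
        obtain ⟨m, hm⟩ := Cardinal.lt_aleph0.1 (Cardinal.lt_aleph0_iff_set_finite.2 hH)
        exact hempty ⟨m, H, hm, not_lt.1 hle⟩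
      obtain ⟨C, hC, ⟨c⟩⟩ := H.coe.exists_coloring_card
      have hCk : #C ≤ #(ULift.{u} (Fin k)) := by
        rw [hC]; simpa using hlt.le
      obtain ⟨e⟩ := Cardinal.le_def C _ |>.1 hCk
      exact ⟨SimpleGraph.Coloring.mk (fun v => (e (c v)).down) (fun {v w} h heq =>
        c.valid h (e.injective (ULift.down_injective heq)))⟩
    obtain ⟨c⟩ := SimpleGraph.nonempty_hom_of_forall_finite_subgraph_hom
      (G := G) (F := (⊤ : SimpleGraph (Fin k))) (fun H hH => (key H hH).some)
    have hle : G.cardChromaticNumber ≤ (k : Cardinal.{u}) :=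
      csInf_le' ⟨ULift.{u} (Fin k), by simp,
        ⟨SimpleGraph.Coloring.mk (fun v => ULift.up (c v)) (fun {v w} h heq =>
          (c.map_adj h) (ULift.up_injective heq))⟩⟩
    exact absurd (hG.trans hle) (not_le.2 (Cardinal.natCast_lt_aleph0))
  exact ⟨Nat.sInf_mem hne, fun m hm => Nat.sInf_le hm⟩

/-!
Fix `ℵ₁` distinct binary sequences `e r`, indexed by `r` in `O = ω₁`. A vertex of the graph is an
index `r` together with a strictly increasing sequence `a : ℕ → O` (and a dummy subset of `O`, which
only brings the number of vertices up to `2 ^ ℵ₁`). Vertices with data `(r, a)` and `(r', b)` are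
adjacent if for some `i` the digits `e r i` and `e r' i` differ and the first `N i` terms of `a` and
`b` are interlaced with a shift, as in the Specker graphs; here `N` grows fast, depending on `f`.

*The chromatic number is `ℵ₁`.* The index `r` is a proper colour. Conversely, let the vertices be
coloured with countably many colours. Call a set of sequences large if, for every `n`, there
are unboundedly many first terms, each followed by unboundedly many second terms, and so on for `n`
steps, all of which lead to initial segments of its members. The sets
that are not large form a σ-ideal (`exists_isLarge`), so for every `r` some colour is assigned to
`(r, a)` for a large set of `a`. Two indices `r ≠ r'` get the same such colour. Two large sets
contain members interleaved in any prescribed finite pattern (`exists_interleaved`), so there is a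
monochromatic edge (`interlaceGraph.isEmpty_coloring_nat`).

*Small subgraphs have small chromatic number.* For any `j`, the edges that come from some `i < j`
are properly coloured by the first `j` digits of `e r`, hence with `2 ^ j` colours. The remaining
edges join sequences that are interlaced up to `N j`. Along a walk of such edges an inequality
between terms of the end sequences is transported while their indices are displaced, and for a
short closed walk with different numbers of ascending and descending edges the outcome contradicts
monotonicity (`SimpleGraph.Walk.not_odd_of_interlaced`). So these edges contain no short odd closed
walk, and a small subgraph is coloured with `2 ^ (j + 1)` colours
(`interlaceGraph.nonempty_coloring_coe`). For given `k`, take `j` with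
`2 ^ (j + 1) ≤ k - 1 < 2 ^ (j + 2)`.
-/

/-! ### Sequences interlaced with a shift -/

/-- `Interlaced N a b`: for every `l < N`, the value `b l` lies strictly between the values of `a`
at `l + s` and `l + s + 1`, where the shift `s = log₂ l` grows slowly with `l`. As the shift is
constant on each block `[2 ^ s, 2 ^ (s + 1))`, this single relation contains, for every `s` with
`2 ^ (s + 1) ≤ N`, the relation of a Specker graph with shift `s`. -/
def Interlaced {O : Type*} [LT O] (N : ℕ) (a b : ℕ → O) : Prop :=
  ∀ l < N, a (l + Nat.log 2 l) < b l ∧ b l < a (l + Nat.log 2 l + 1)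

theorem Interlaced.mono {O : Type*} [LT O] {M N : ℕ} (h : M ≤ N) {a b : ℕ → O}
    (hab : Interlaced N a b) : Interlaced M a b :=
  fun l hl => hab l (hl.trans_le h)

theorem Interlaced.shift {O : Type*} [LT O] {N s : ℕ} (hN : 2 ^ (s + 1) ≤ N) {a b : ℕ → O}
    (hab : Interlaced N a b) (l : ℕ) (h₁ : 2 ^ s ≤ l) (h₂ : l < 2 ^ (s + 1)) :
    a (l + s) < b l ∧ b l < a (l + s + 1) := by
  have h := hab l (h₂.trans_le hN)
  rwa [Nat.log_eq_of_pow_le_of_lt_pow h₁ h₂] at h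

/-- Comparison of the sequences at the two ends of a walk. A step from the lower to the upper
sequence of an edge moves an index by `-s` if values are to increase and by `-(s + 1)` if they are
to decrease; a step in the other direction moves it by `s + 1` and by `s`. If the walk makes `m`
steps of the first kind and `n` of the second, the total displacements are
`n * (s + 1) - m * s` and `n * s - m * (s + 1)`. -/
theorem SimpleGraph.Walk.exists_shift {W O : Type*} [Preorder O] {K : SimpleGraph W}
    {a : W → ℕ → O} {s P Q : ℕ}
    (hK : ∀ u v, K.Adj u v →
      (∀ l, P ≤ l → l < Q → a u (l + s) < a v l ∧ a v l < a u (l + s + 1)) ∨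
      (∀ l, P ≤ l → l < Q → a v (l + s) < a u l ∧ a u l < a v (l + s + 1)))
    {u v : W} (p : K.Walk u v) :
    ∃ m n, m + n = p.length ∧ ∀ l, P + p.length * (s + 1) ≤ l → l + p.length * (s + 1) ≤ Q →
      ∀ l', (l' + m * s = l + n * (s + 1) → a u l ≤ a v l') ∧
        (l' + m * (s + 1) = l + n * s → a v l' ≤ a u l) := by
  induction p with
  | nil =>
    refine ⟨0, 0, rfl, fun l _ _ l' => ⟨fun h => ?_, fun h => ?_⟩⟩ <;>
    · obtain rfl : l' = l := by simpa using h
      exact le_rfl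
  | @cons u v w huv p ih =>
    obtain ⟨m, n, hmn, h⟩ := ih
    rw [SimpleGraph.Walk.length_cons]
    rcases hK _ _ huv with hb | hb
    · refine ⟨m + 1, n, by omega, fun l h₁ h₂ l' => ⟨fun hl => ?_, fun hl => ?_⟩⟩
      · have e : l - s + s = l := by lia
        have := (h (l - s) (by lia) (by lia) l').1 (by lia)
        have := ((hb (l - s) (by lia) (by lia)).1.trans_le this).le
        rwa [e] at this
      · have e : l - (s + 1) + s + 1 = l := by lia
        have := (h (l - (s + 1)) (by lia) (by lia) l').2 (by lia)
        have := (this.trans_lt (hb (l - (s + 1)) (by lia) (by lia)).2).le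
        rwa [e] at this
    · refine ⟨m, n + 1, by omega, fun l h₁ h₂ l' => ⟨fun hl => ?_, fun hl => ?_⟩⟩
      · exact (hb l (by lia) (by lia)).2.le.trans ((h (l + s + 1) (by lia) (by lia) l').1 (by lia))
      · exact ((h (l + s) (by lia) (by lia) l').2 (by lia)).trans (hb l (by lia) (by lia)).1.le

/-- A graph whose edges join interlaced strictly increasing sequences has no short odd closed
walk. -/
theorem SimpleGraph.Walk.not_odd_of_interlaced {W O : Type*} [Preorder O] {K : SimpleGraph W}
    {a : W → ℕ → O} (ha : ∀ v, StrictMono (a v)) {N s : ℕ} (hN : 2 ^ (s + 1) ≤ N)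
    (hK : ∀ u v, K.Adj u v → Interlaced N (a u) (a v) ∨ Interlaced N (a v) (a u))
    {v : W} (p : K.Walk v v) (hs : p.length < s) (hp : 2 * (p.length * (s + 1)) ≤ 2 ^ s) :
    ¬ Odd p.length := by
  intro hodd
  obtain ⟨m, n, hmn, h⟩ := p.exists_shift (a := a) (s := s) (P := 2 ^ s) (Q := 2 ^ (s + 1))
    fun u v huv => (hK u v huv).imp (fun h => h.shift hN) (fun h => h.shift hN)
  have hQ : 2 ^ (s + 1) = 2 * 2 ^ s := by ring
  have hne : m ≠ n := by
    rintro rfl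
    rw [← hmn] at hodd
    exact Nat.not_odd_iff_even.2 ⟨m, rfl⟩ hodd
  -- the middle of the block, from which no walk of this length leaves the block
  set l := 2 ^ s + p.length * (s + 1) with hl
  have hms : m * (s + 1) ≤ l := by
    have := Nat.mul_le_mul_right (s + 1) (show m ≤ p.length by omega)
    lia
  rcases lt_or_gt_of_ne hne with hlt | hlt
  · -- displacement `n * s - m * (s + 1) ≥ s - m > 0`, yet the value does not increase
    have key : l < l + n * s - m * (s + 1) := by
      have := Nat.mul_le_mul_right s (show m + 1 ≤ n from hlt)
      lia
    exact (ha v key).not_ge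
      ((h l le_rfl (by omega) (l + n * s - m * (s + 1))).2 (by lia))
  · -- displacement `n * (s + 1) - m * s ≤ n - s < 0`, yet the value does not decrease
    have key : l + n * (s + 1) - m * s < l := by
      have := Nat.mul_le_mul_right s (show n + 1 ≤ m from hlt)
      lia
    exact (ha v key).not_ge
      ((h l le_rfl (by omega) (l + n * (s + 1) - m * s)).1 (by lia))

/-- A finite graph without odd closed walks of length less than twice its order is bipartite: give
each vertex the parity of the length of a path to it from a root of its component. -/
theorem SimpleGraph.nonempty_coloring_bool_of_closed_walks {W : Type*} [Finite W]
    {K : SimpleGraph W}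
    (h : ∀ (v : W) (p : K.Walk v v), p.length < 2 * Nat.card W → ¬ Odd p.length) :
    Nonempty (K.Coloring Bool) := by
  classical
  have := Fintype.ofFinite W
  have hroot : ∀ v, ∃ p : K.Walk (K.connectedComponentMk v).out v, p.length < Nat.card W := by
    intro v
    obtain ⟨p⟩ := SimpleGraph.ConnectedComponent.exact (K.connectedComponentMk v).out_eq
    exact ⟨p.bypass, p.bypass_isPath.length_lt.trans_eq Nat.card_eq_fintype_card.symm⟩
  choose p hp using hroot
  refine ⟨SimpleGraph.Coloring.mk (fun v => decide (Odd (p v).length)) ?_⟩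
  intro u v huv heq
  have hc : (K.connectedComponentMk v).out = (K.connectedComponentMk u).out := by
    rw [SimpleGraph.ConnectedComponent.sound huv.reachable]
  have hu := hp u
  have hv := hp v
  refine h _ (((p u).append (.cons huv (p v).reverse)).copy rfl hc) ?_ ?_
  · simp only [SimpleGraph.Walk.length_copy, SimpleGraph.Walk.length_append,
      SimpleGraph.Walk.length_cons, SimpleGraph.Walk.length_reverse]
    omega
  · simp only [decide_eq_decide] at heq
    simp only [SimpleGraph.Walk.length_copy, SimpleGraph.Walk.length_append,
      SimpleGraph.Walk.length_cons, SimpleGraph.Walk.length_reverse]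
    grind

/-! ### Large sets of sequences -/

/-- `IsLarge A n p x`: unboundedly many values `x p` can be followed by unboundedly many values
`x (p + 1)`, and so on for `n` steps, such that each sequence `x 0, …, x (p + n - 1)` so obtained is
an initial segment of a member of `A`. Only the values of `x` below `p` matter. -/
def IsLarge {O : Type*} [LT O] (A : Set (ℕ → O)) : ℕ → ℕ → (ℕ → O) → Prop
  | 0, p, x => ∃ a ∈ A, ∀ i < p, a i = x i
  | n + 1, p, x => ∀ β, ∃ γ, β < γ ∧ IsLarge A n (p + 1) (Function.update x p γ)

/-- The sets that are not large form a σ-ideal: if `A k` fails to be large then some bound for each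
next value witnesses this, and a strictly increasing sequence that exceeds all these bounds lies in
no `A k`. -/
theorem exists_isLarge {O : Type*} [LinearOrder O]
    (hO : ∀ S : Set O, S.Countable → ∃ γ, ∀ x ∈ S, x < γ) (A : ℕ → Set (ℕ → O))
    (hA : ∀ a, StrictMono a → ∃ k, a ∈ A k) (x₀ : ℕ → O) :
    ∃ k, ∀ n, IsLarge (A k) n 0 x₀ := by
  by_contra! hcon
  have hβ : ∀ k n p x, ∃ β, ¬ IsLarge (A k) (n + 1) p x →
      ∀ γ, β < γ → ¬ IsLarge (A k) n (p + 1) (Function.update x p γ) := by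
    intro k n p x
    by_cases h : IsLarge (A k) (n + 1) p x
    · exact ⟨x 0, fun h' => absurd h h'⟩
    · rw [IsLarge] at h
      push Not at h
      exact h.imp fun β hβ _ => hβ
  choose β hβ using hβ
  have hg : ∀ p (x : ℕ → O), ∃ γ, (∀ k n, β k n p x < γ) ∧ ∀ i, x i < γ := by
    intro p x
    obtain ⟨γ, hγ⟩ := hO (Set.range (fun kn : ℕ × ℕ => β kn.1 kn.2 p x) ∪ Set.range x)
      ((Set.countable_range _).union (Set.countable_range _))
    exact ⟨γ, fun k n => hγ _ (.inl ⟨(k, n), rfl⟩), fun i => hγ _ (.inr ⟨i, rfl⟩)⟩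
  choose g hgβ hgx using hg
  let X : ℕ → ℕ → O := fun p => Nat.rec x₀ (fun p x => Function.update x p (g p x)) p
  have hX : ∀ p, X (p + 1) = Function.update (X p) p (g p (X p)) := fun _ => rfl
  let a : ℕ → O := fun p => g p (X p)
  have haX : ∀ p, ∀ i < p, a i = X p i := by
    intro p
    induction p with
    | zero => intro i hi; omega
    | succ p ih =>
      intro i hi
      rw [hX]
      rcases Nat.lt_succ_iff_lt_or_eq.1 hi with h | rfl
      · rw [Function.update_of_ne h.ne, ih i h]
      · rw [Function.update_self]
  have ha : StrictMono a := strictMono_nat_of_lt_succ fun p => by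
    rw [haX (p + 1) p p.lt_succ_self]
    exact hgx _ _ _
  obtain ⟨k, hk⟩ := hA a ha
  obtain ⟨n, hn⟩ := hcon k
  have hinv : ∀ p q, q + p = n → ¬ IsLarge (A k) q p (X p) := by
    intro p
    induction p with
    | zero => rintro q rfl; exact hn
    | succ p ih =>
      intro q hq
      exact hβ k q p (X p) (ih (q + 1) (by omega)) _ (hgβ _ _ _ _)
  exact hinv n 0 (by omega) ⟨a, hk, haX n⟩

/-- Members of two large sets can be interleaved in a prescribed pattern. The values `a i` with
`i ≤ h l` are to be chosen before `b l`, the others after it; each new value is chosen above all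
earlier ones. At the stage described by `p` and `q`, the values `x i` with `i < p` of the first
sequence and `y l` with `l < q` of the second have been chosen. -/
theorem exists_interleaved {O : Type*} [LinearOrder O]
    (hO : ∀ S : Set O, S.Countable → ∃ γ, ∀ x ∈ S, x < γ) {A B : Set (ℕ → O)} {h : ℕ → ℕ}
    (hh : Monotone h) : ∀ (t n m p q : ℕ) (x y : ℕ → O), n + m = t →
      IsLarge A n p x → IsLarge B m q y →
      (∀ l < q + m, h l < p + n) → (∀ l < q, h l < p) →
      (∀ l < q + m, q ≤ l → ∀ i < p, i ≤ h l) →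
      ∃ a ∈ A, ∃ b ∈ B, (∀ i < p, a i = x i) ∧ (∀ l < q, b l = y l) ∧
        ∀ l < q + m, ∀ i < p + n, q ≤ l ∨ p ≤ i →
          (i ≤ h l → a i < b l) ∧ (h l < i → b l < a i) := by
  have hγ : ∀ x y : ℕ → O, ∃ γ, ∀ i, x i < γ ∧ y i < γ := by
    intro x y
    obtain ⟨γ, hγ⟩ := hO (Set.range x ∪ Set.range y)
      ((Set.countable_range _).union (Set.countable_range _))
    exact ⟨γ, fun i => ⟨hγ _ (.inl ⟨i, rfl⟩), hγ _ (.inr ⟨i, rfl⟩)⟩⟩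
  intro t
  induction t with
  | zero =>
    intro n m p q x y ht hA hB _ _ _
    obtain ⟨rfl, rfl⟩ : n = 0 ∧ m = 0 := by omega
    obtain ⟨a, ha, hax⟩ := hA
    obtain ⟨b, hb, hby⟩ := hB
    exact ⟨a, ha, b, hb, hax, hby, fun l hl i hi hli => by omega⟩
  | succ t ih =>
    intro n m p q x y ht hA hB h₁ h₂ h₃
    obtain ⟨β, hβ⟩ := hγ x y
    by_cases hm : m = 0 ∨ p ≤ h q
    · -- the next value to be chosen is `a p`
      obtain ⟨n, rfl⟩ : ∃ n', n = n' + 1 := by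
        refine Nat.exists_eq_succ_of_ne_zero fun hn => ?_
        rcases hm with hm | hm
        · omega
        · have := h₁ q (by omega)
          omega
      obtain ⟨γ, hβγ, hA⟩ := hA β
      obtain ⟨a, ha, b, hb, hax, hby, hab⟩ := ih n m (p + 1) q _ y (by omega) hA hB
        (fun l hl => by have := h₁ l hl; omega) (fun l hl => (h₂ l hl).trans p.lt_succ_self)
        (fun l hl hql i hi => by
          rcases hm with hm | hm
          · omega
          · have := hh hql
            omega)
      refine ⟨a, ha, b, hb, fun i hi => ?_, hby, fun l hl i hi hli => ?_⟩
      · rw [hax i (by omega), Function.update_of_ne hi.ne]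
      · by_cases hli' : q ≤ l ∨ p + 1 ≤ i
        · exact hab l hl i (by omega) hli'
        · obtain rfl : i = p := by omega
          have := h₂ l (by omega)
          refine ⟨fun _ => by omega, fun _ => ?_⟩
          rw [hby l (by omega), hax i (by omega), Function.update_self]
          exact (hβ l).2.trans hβγ
    · -- the next value to be chosen is `b q`
      push Not at hm
      obtain ⟨m, rfl⟩ := Nat.exists_eq_succ_of_ne_zero hm.1
      obtain ⟨γ, hβγ, hB⟩ := hB β
      obtain ⟨a, ha, b, hb, hax, hby, hab⟩ := ih n m p (q + 1) x _ (by omega) hA hB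
        (fun l hl => h₁ l (by omega))
        (fun l hl => by
          rcases Nat.lt_succ_iff_lt_or_eq.1 hl with hl | rfl
          · exact h₂ l hl
          · exact hm.2)
        (fun l hl hql i hi => h₃ l (by omega) (by omega) i hi)
      refine ⟨a, ha, b, hb, hax, fun l hl => ?_, fun l hl i hi hli => ?_⟩
      · rw [hby l (by omega), Function.update_of_ne hl.ne]
      · by_cases hli' : q + 1 ≤ l ∨ p ≤ i
        · exact hab l (by omega) i hi hli'
        · obtain rfl : l = q := by omega
          have := h₃ l hl le_rfl i (by omega)
          refine ⟨fun _ => ?_, fun _ => by omega⟩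
          rw [hby l (by omega), hax i (by omega), Function.update_self]
          exact (hβ i).1.trans hβγ

theorem exists_interlaced {O : Type*} [LinearOrder O]
    (hO : ∀ S : Set O, S.Countable → ∃ γ, ∀ x ∈ S, x < γ) {A B : Set (ℕ → O)} {x y : ℕ → O}
    (hA : ∀ n, IsLarge A n 0 x) (hB : ∀ n, IsLarge B n 0 y) (N : ℕ) :
    ∃ a ∈ A, ∃ b ∈ B, Interlaced N a b := by
  have hh : Monotone fun l => l + Nat.log 2 l :=
    fun l l' hl => Nat.add_le_add hl (Nat.log_mono_right hl)
  have hN : ∀ l < N, l + Nat.log 2 l + 1 < N + Nat.log 2 N + 1 :=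
    fun l hl => by have := Nat.log_mono_right (b := 2) hl.le; omega
  obtain ⟨a, ha, b, hb, -, -, hab⟩ := exists_interleaved hO hh _ (N + Nat.log 2 N + 1) N 0 0 x y rfl
    (hA _) (hB _) (fun l hl => by have := hN l (by omega); omega)
    (fun l hl => by omega) (fun l _ _ i hi => by omega)
  refine ⟨a, ha, b, hb, fun l hl => ?_⟩
  have hl' := hN l hl
  exact ⟨(hab l (by omega) _ (by omega) (.inl l.zero_le)).1 le_rfl,
    (hab l (by omega) _ (by omega) (.inl l.zero_le)).2 (Nat.lt_succ_self _)⟩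

/-! ### The graph -/

/-- The vertices are triples of an index `r : R`, a strictly increasing sequence in `O`, and an
element of `X` that plays no role in the adjacency (it serves to enlarge the vertex set). Vertices
with indices `r` and `r'` are adjacent if, for some `i` with `e r i ≠ e r' i`, their sequences are
interlaced up to `N i` in one of the two orders. -/
def interlaceGraph {R : Type*} (e : R → ℕ → Bool) (N : ℕ → ℕ) (O X : Type*) [Preorder O] :
    SimpleGraph (R × {a : ℕ → O // StrictMono a} × X) where
  Adj v w := ∃ i, e v.1 i ≠ e w.1 i ∧
    (Interlaced (N i) v.2.1.1 w.2.1.1 ∨ Interlaced (N i) w.2.1.1 v.2.1.1)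
  symm := ⟨fun _ _ ⟨i, hi, h⟩ => ⟨i, hi.symm, h.symm⟩⟩
  loopless := ⟨fun _ ⟨_, hi, _⟩ => hi rfl⟩

/-- The index `r` is a proper colour. -/
def interlaceGraph.indexColoring {R : Type*} (e : R → ℕ → Bool) (N : ℕ → ℕ) (O X : Type*)
    [Preorder O] : (interlaceGraph e N O X).Coloring R :=
  SimpleGraph.Coloring.mk Prod.fst fun {_ _} ⟨_, hi, _⟩ h => hi (by rw [h])

/-- There are two indices for which sequences of the same colour form large sets, and these two sets
contain interlaced sequences. -/
theorem interlaceGraph.isEmpty_coloring_nat {R O X : Type*} [Uncountable R] [Nonempty X]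
    [LinearOrder O] (hO : ∀ S : Set O, S.Countable → ∃ γ, ∀ x ∈ S, x < γ) {e : R → ℕ → Bool}
    (he : Function.Injective e) (N : ℕ → ℕ) : IsEmpty ((interlaceGraph e N O X).Coloring ℕ) := by
  refine ⟨fun c => ?_⟩
  obtain ⟨o, -⟩ := hO ∅ Set.countable_empty
  obtain ⟨z⟩ := ‹Nonempty X›
  have hk : ∀ r, ∃ k, ∀ n,
      IsLarge {a | ∃ ha : StrictMono a, c (r, ⟨a, ha⟩, z) = k} n 0 (fun _ => o) := fun r =>
    exists_isLarge hO (fun k => {a | ∃ ha : StrictMono a, c (r, ⟨a, ha⟩, z) = k})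
      (fun a ha => ⟨_, ha, rfl⟩) _
  choose k hk using hk
  obtain ⟨r, r', hrr, hne⟩ : ∃ r r', k r = k r' ∧ r ≠ r' := by
    by_contra! h
    have hinj : Function.Injective k := fun r r' => h r r'
    exact not_countable hinj.countable
  obtain ⟨i, hi⟩ := Function.ne_iff.1 (he.ne hne)
  obtain ⟨a, ⟨ha, hca⟩, b, ⟨hb, hcb⟩, hab⟩ := exists_interlaced hO (hk r) (hk r') (N i)
  exact c.valid (v := (r, ⟨a, ha⟩, z)) (w := (r', ⟨b, hb⟩, z)) ⟨i, hi, .inl hab⟩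
    (hca.trans (hrr.trans hcb.symm))

theorem Nat.two_mul_mul_le_two_pow {m L s : ℕ} (hL : L < 2 * m) (hs : s = 2 * m + 8) :
    2 * (L * (s + 1)) ≤ 2 ^ s := by
  have key : ∀ n : ℕ, 2 * (n * (n + 9)) ≤ 2 ^ (n + 8) := by
    intro n
    induction n with
    | zero => simp
    | succ n ih =>
      have : n + 8 < 2 ^ (n + 8) := Nat.lt_two_pow_self
      have e : 2 ^ (n + 1 + 8) = 2 * 2 ^ (n + 8) := by ring
      rcases Nat.lt_or_ge n 3 with hn | hn
      · interval_cases n <;> norm_num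
      · rw [e]
        nlinarith
  subst hs
  exact (Nat.mul_le_mul_left 2 (Nat.mul_le_mul_right _ hL.le)).trans (key (2 * m))

/-- In a subgraph of order at most `m`, the edges coming from some `i < j` are taken care of by the
first `j` digits of `e r`, and the other edges form a bipartite graph. -/
theorem interlaceGraph.nonempty_coloring_coe {R O X : Type*} [LinearOrder O] {e : R → ℕ → Bool}
    {N : ℕ → ℕ} (hN : Monotone N) (H : (interlaceGraph e N O X).Subgraph) (hfin : H.verts.Finite)
    {m j : ℕ} (hm : Nat.card H.verts ≤ m) (hj : 2 ^ (2 * m + 9) ≤ N j) :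
    Nonempty (H.coe.Coloring ((Fin j → Bool) × Bool)) := by
  have := hfin.to_subtype
  let a : H.verts → ℕ → O := fun v => v.1.2.1.1
  let K : SimpleGraph H.verts :=
    { Adj := fun v w => v ≠ w ∧ (Interlaced (N j) (a v) (a w) ∨ Interlaced (N j) (a w) (a v))
      symm := ⟨fun _ _ h => ⟨h.1.symm, h.2.symm⟩⟩
      loopless := ⟨fun _ h => h.1 rfl⟩ }
  obtain ⟨c⟩ := K.nonempty_coloring_bool_of_closed_walks fun v p hp =>
    p.not_odd_of_interlaced (a := a) (s := 2 * m + 8) (fun v => v.1.2.1.2) hj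
      (fun v w (h : v ≠ w ∧ _) => h.2) (by omega)
      (Nat.two_mul_mul_le_two_pow (hp.trans_le (by omega)) rfl)
  refine ⟨SimpleGraph.Coloring.mk (fun v => (fun i => e v.1.1 i, c v)) fun {v w} hvw heq => ?_⟩
  obtain ⟨i, hi, h⟩ := H.adj_sub hvw
  rw [Prod.mk.injEq] at heq
  rcases Nat.lt_or_ge i j with hij | hij
  · exact hi (congrFun heq.1 ⟨i, hij⟩)
  · exact c.valid (v := v) (w := w) ⟨fun hvw' => hi (by rw [hvw']),
      h.imp (fun h => h.mono (hN hij)) (fun h => h.mono (hN hij))⟩ heq.2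

/-! ### Cardinalities -/

theorem SimpleGraph.cardChromaticNumber_le {V C : Type u} {G : SimpleGraph V} (c : G.Coloring C) :
    G.cardChromaticNumber ≤ #C :=
  csInf_le' ⟨C, rfl, ⟨c⟩⟩

theorem SimpleGraph.aleph_one_le_cardChromaticNumber {V : Type u} {G : SimpleGraph V}
    (h : IsEmpty (G.Coloring ℕ)) : ℵ₁ ≤ G.cardChromaticNumber := by
  by_contra hlt
  obtain ⟨C, hC, ⟨c⟩⟩ := G.exists_coloring_card
  rw [not_le, ← hC, lt_aleph_one_iff, mk_le_aleph0_iff] at hlt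
  obtain ⟨ι, hι⟩ := exists_injective_nat C
  exact h.false (SimpleGraph.Coloring.mk (fun v => ι (c v)) fun hvw heq => c.valid hvw (hι heq))

theorem Ordinal.exists_forall_lt_of_countable (S : Set (Ordinal.omega 1).ToType)
    (hS : S.Countable) : ∃ γ, ∀ x ∈ S, x < γ := by
  by_contra! h
  have := Order.cof_le (show IsCofinal S from h)
  rw [Ordinal.cof_toType, cof_omega_one] at this
  exact (this.trans (le_aleph0_iff_set_countable.2 hS)).not_gt aleph0_lt_aleph_one

theorem exists_injective_binary_sequence {O : Type u} (hO : #O = ℵ₁) :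
    ∃ e : O → ℕ → Bool, Function.Injective e := by
  have h : lift.{0} #O ≤ lift.{u} #(ℕ → Bool) := by
    simpa [hO] using aleph_one_le_continuum
  obtain ⟨e⟩ := lift_mk_le'.1 h
  exact ⟨e, e.injective⟩

theorem mk_interlaceGraph_vertices {O : Type u} [LinearOrder O] (hO : #O = ℵ₁)
    [Nonempty {a : ℕ → O // StrictMono a}] :
    #(O × {a : ℕ → O // StrictMono a} × Set O) = 2 ^ (ℵ₁ : Cardinal.{u}) := by
  have h₂ : ℵ₁ ≤ 2 ^ (ℵ₁ : Cardinal.{u}) := (cantor _).le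
  have h₀ : ℵ₀ ≤ 2 ^ (ℵ₁ : Cardinal.{u}) := aleph0_lt_aleph_one.le.trans h₂
  have hS : #{a : ℕ → O // StrictMono a} ≤ 2 ^ (ℵ₁ : Cardinal.{u}) := by
    refine (mk_subtype_le _).trans ?_
    rw [mk_arrow, hO, mk_nat, lift_aleph0, lift_id']
    calc (ℵ₁ : Cardinal.{u}) ^ (ℵ₀ : Cardinal.{u}) ≤ ℵ₁ ^ (ℵ₁ : Cardinal.{u}) :=
          power_le_power_left (aleph_pos 1).ne' aleph0_lt_aleph_one.le
      _ = 2 ^ (ℵ₁ : Cardinal.{u}) := power_self_eq aleph0_lt_aleph_one.le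
  rw [mk_prod, mk_prod, mk_set, hO]
  simp only [lift_id]
  rw [Cardinal.mul_eq_right h₀ hS (mk_ne_zero _), Cardinal.mul_eq_right h₀ h₂ (aleph_pos 1).ne']

/-! ### Existence of the graph -/

theorem theoremA (f : ℕ → ℕ) :
    ∃ (V : Type u) (G : SimpleGraph V),
      #V = 2 ^ (ℵ₁ : Cardinal.{u}) ∧
      G.cardChromaticNumber = ℵ₁ ∧
      ∀ k : ℕ, 3 ≤ k →
        (∀ H : G.Subgraph, #H.verts < (f k : Cardinal.{u}) →
          H.coe.cardChromaticNumber < (k : Cardinal.{u})) ∧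
        f k ≤ G.leastSubgraphOrder k := by
  let O : Type u := (Ordinal.omega 1).ToType
  have hO : #O = ℵ₁ := by simp [O]
  have hbd : ∀ S : Set O, S.Countable → ∃ γ, ∀ x ∈ S, x < γ :=
    Ordinal.exists_forall_lt_of_countable
  have : Uncountable O := aleph0_lt_mk_iff.1 (hO ▸ aleph0_lt_aleph_one)
  have : NoMaxOrder O := ⟨fun x => (hbd {x} (Set.countable_singleton x)).imp fun γ h => h x rfl⟩
  have : Nonempty {a : ℕ → O // StrictMono a} := nonempty_subtype.2 (Nat.exists_strictMono O)
  obtain ⟨e, he⟩ := exists_injective_binary_sequence hO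
  -- `F j` bounds `f k` for all those `k` whose subgraphs are to be coloured with `2 ^ (j + 1)`
  -- colours
  let F : ℕ → ℕ := fun j => ∑ k ∈ Finset.range (2 ^ (j + 2) + 1), f k
  let N : ℕ → ℕ := fun j => 2 ^ (2 * F j + 9)
  have hF : Monotone F := fun i j hij => Finset.sum_le_sum_of_subset <|
    Finset.range_mono <| by gcongr; norm_num
  have hN : Monotone N := fun i j hij => by
    have := hF hij
    exact Nat.pow_le_pow_right two_pos (by omega)
  let G := interlaceGraph e N O (Set O)
  have hχ : G.cardChromaticNumber = ℵ₁ := le_antisymm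
    ((SimpleGraph.cardChromaticNumber_le (interlaceGraph.indexColoring e N O (Set O))).trans hO.le)
    (SimpleGraph.aleph_one_le_cardChromaticNumber
      (interlaceGraph.isEmpty_coloring_nat hbd he N))
  refine ⟨_, G, mk_interlaceGraph_vertices hO, hχ, fun k hk => ?_⟩
  have hsmall : ∀ H : G.Subgraph, #H.verts < (f k : Cardinal.{u}) →
      H.coe.cardChromaticNumber < (k : Cardinal.{u}) := by
    intro H hH
    obtain ⟨j, hj⟩ : ∃ j, Nat.log 2 (k - 1) = j + 1 :=
      Nat.exists_eq_succ_of_ne_zero (Nat.log_pos one_lt_two (by omega)).ne'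
    have hjk : 2 ^ (j + 1) ≤ k - 1 := hj ▸ Nat.pow_log_le_self 2 (by omega)
    have hkj : k - 1 < 2 ^ (j + 2) := by
      simpa only [hj] using Nat.lt_pow_succ_log_self one_lt_two (k - 1)
    have hfin : H.verts.Finite := lt_aleph0_iff_set_finite.1 (hH.trans natCast_lt_aleph0)
    have hcard : Nat.card H.verts ≤ F j := by
      have := hfin.to_subtype
      have hlt : Nat.card H.verts < f k := by
        rw [← Nat.cast_lt (α := Cardinal.{u}), Nat.cast_card]
        exact hH
      exact hlt.le.trans (Finset.single_le_sum (f := f) (fun _ _ => Nat.zero_le _)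
        (Finset.mem_range.2 (by omega)))
    obtain ⟨c⟩ := interlaceGraph.nonempty_coloring_coe hN H hfin hcard le_rfl
    have hle : H.coe.cardChromaticNumber ≤ ((2 ^ (j + 1) : ℕ) : Cardinal.{u}) := by
      refine (SimpleGraph.cardChromaticNumber_le (C := ULift.{u} ((Fin j → Bool) × Bool))
        (SimpleGraph.Coloring.mk (fun v => ULift.up (c v))
          fun hvw heq => c.valid hvw (ULift.up_injective heq))).trans_eq ?_
      simp [pow_succ]
    exact hle.trans_lt (Nat.cast_lt.2 (by omega))
  refine ⟨hsmall, ?_⟩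
  obtain ⟨H, hH, hkH⟩ :=
    (G.isLeast_leastSubgraphOrder (hχ ▸ aleph0_lt_aleph_one.le) k).1
  by_contra hlt
  exact (hsmall H (hH ▸ Nat.cast_lt.2 (not_le.1 hlt))).not_ge hkH
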